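/- For $n\ge 1$, a permutation $\sigma$ of $[n]=\{1,\dots,n\}$ is alternating if $\sigma(1)<\sigma(2)>\sigma(3)<\sigma(4)>\cdots$ (strictly alternating inequalities up to $\sigma(n)$), and it is cyclically alternating if, in addition, $n$ is even and $\sigma(n)>\sigma(1)$. Let $A(n)$ be the number of alternating permutations of $[n]$ and, for even $n$, let $A_0(n)$ be the number of cyclically alternating ones. For $n\ge 2$ let $$S(n)=\sum_{k=-\infty}^{\infty}\frac{1}{(4k+1)^n},$$ which converges absolutely. Then for every integer $m\ge 1$, $$\frac{A_0(2m)}{A(2m)}=m\,\frac{A(2m-1)}{A(2m)}=\frac{\pi}{4}\cdot\frac{S(2m)}{S(2m+1)},$$ and this ratio is the probability $p_m$ that a uniformly random alternating permutation of $[2m]$ is cyclically alternating. As $m\to\infty$ it tends to $\pi/4$, and the error is asymptotically a constant multiple of $3^{-2m}$: there is a constant $c>0$ such that $$p_m-\frac{\pi}{4}\sim c\cdot 3^{-2m}\qquad(m\to\infty).$$ -/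

import Mathlib

open Filter Topology Asymptotics

noncomputable section

namespace AltPerm

/-- `σ(1) < σ(2) > σ(3) < σ(4) > ⋯`. The points of `[n]` are numbered `0, …, n - 1` here, so the
inequality between positions `i` and `i + 1` is `<` when `i` is even and `>` when `i` is odd. -/
def IsAlternating {n : ℕ} (σ : Equiv.Perm (Fin n)) : Prop :=
  ∀ (i : ℕ) (h : i + 1 < n),
    (Even i → σ ⟨i, Nat.lt_of_succ_lt h⟩ < σ ⟨i + 1, h⟩) ∧
    (Odd i → σ ⟨i + 1, h⟩ < σ ⟨i, Nat.lt_of_succ_lt h⟩)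

/-- An alternating permutation of `[n]` with `n` even and `σ(n) > σ(1)`. -/
def IsCyclicallyAlternating {n : ℕ} (σ : Equiv.Perm (Fin n)) : Prop :=
  IsAlternating σ ∧ Even n ∧
    ∀ h : 0 < n, σ ⟨0, h⟩ < σ ⟨n - 1, Nat.sub_lt h Nat.one_pos⟩

/-- The number `A(n)` of alternating permutations of `[n]`. -/
def A (n : ℕ) : ℕ := Nat.card {σ : Equiv.Perm (Fin n) // IsAlternating σ}

/-- The number `A₀(n)` of cyclically alternating permutations of `[n]`. -/
def A₀ (n : ℕ) : ℕ := Nat.card {σ : Equiv.Perm (Fin n) // IsCyclicallyAlternating σ}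

/-- `S(n) = ∑_{k ∈ ℤ} 1 / (4k + 1)^n`, for `n ≥ 2`, where the sum converges absolutely. -/
def S (n : ℕ) : ℝ := ∑' k : ℤ, 1 / (4 * (k : ℝ) + 1) ^ n

/-- The probability that a uniformly random alternating permutation of `[n]` is cyclically
alternating. -/
def probCyclic (n : ℕ) : ℝ :=
  letI : MeasurableSpace (Equiv.Perm (Fin n)) := ⊤
  (ProbabilityTheory.uniformOn {σ : Equiv.Perm (Fin n) | IsAlternating σ}).real
    {σ | IsCyclicallyAlternating σ}

end AltPerm

end

/-! Counting. In a cyclically alternating permutation of `[2m]` the maximum occupies one of the `m`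
peaks. Rotating it to the end and deleting it leaves an alternating permutation of `[2m - 1]`, so
`A₀ (2m) = m * A (2m - 1)` (`A₀_two_mul_succ`).

Analysis. Let `f_n(x)` be the volume of the chains `x < x₁ > x₂ < ⋯` of `n` further points of `[0,
1]`; sorting them by the rank of `x` gives `entringerPoly`. Then `f_{n+1}'(x) = -f_n(1 - x)`,
`f_{n+1}(1) = 0`, and `f_n(0) = A n / n!` for `n ≥ 1`. The functions `cos (λ x)` with `cos λ = 0`,
`sin λ = 1` diagonalise this recursion, so `f_n` is the cosine series `cosSeries n`
(`entringerPoly_eq_cosSeries`), and at `x = 0` this expresses `A n` through `S (n + 1)` (`A_eq`).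
The ratio formula follows.

Asymptotics. The term `k = 0` of `S n` is `1` and `k = -1` gives the next order, `(-3)⁻ⁿ`. Hence `S
(2m) - S (2m + 1) ~ (1 + 1/3) * 3⁻²ᵐ`, so `c = (π/4) * (4/3) = π/3`. -/

noncomputable section

namespace AltPerm

/-! ### Inserting a value into a permutation -/

/-- The permutation of `Fin (n + 1)` sending `a` to `b` and inducing `τ` on the remaining points,
both sides relabelled in increasing order. -/
def insertPerm {n : ℕ} (a b : Fin (n + 1)) (τ : Equiv.Perm (Fin n)) : Equiv.Perm (Fin (n + 1)) :=
  ((finSuccEquiv' a).trans τ.optionCongr).trans (finSuccEquiv' b).symm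

@[simp]
lemma insertPerm_self {n : ℕ} (a b : Fin (n + 1)) (τ : Equiv.Perm (Fin n)) :
    insertPerm a b τ a = b := by
  simp [insertPerm]

@[simp]
lemma insertPerm_succAbove {n : ℕ} (a b : Fin (n + 1)) (τ : Equiv.Perm (Fin n)) (i : Fin n) :
    insertPerm a b τ (a.succAbove i) = b.succAbove (τ i) := by
  simp [insertPerm]

lemma insertPerm_injective {n : ℕ} (a b : Fin (n + 1)) :
    Function.Injective (insertPerm (n := n) a b) := by
  intro τ τ' h
  ext1 i
  have := DFunLike.congr_fun h (a.succAbove i)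
  simpa using this

lemma exists_insertPerm_eq {n : ℕ} {a b : Fin (n + 1)} {σ : Equiv.Perm (Fin (n + 1))}
    (h : σ a = b) : ∃ τ, insertPerm a b τ = σ := by
  have hne : ∀ i, σ (a.succAbove i) ≠ b := fun i hi =>
    Fin.succAbove_ne a i (σ.injective (hi.trans h.symm))
  choose f hf using fun i => Fin.exists_succAbove_eq (hne i)
  have hinj : Function.Injective f := by
    intro i j hij
    have : σ (a.succAbove i) = σ (a.succAbove j) := by rw [← hf i, ← hf j, hij]
    exact Fin.succAbove_right_injective (σ.injective this)
  refine ⟨Equiv.ofBijective f (Finite.injective_iff_bijective.1 hinj), ?_⟩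
  ext1 x
  rcases Fin.eq_self_or_eq_succAbove a x with rfl | ⟨i, rfl⟩
  · simp [h]
  · simp [hf]

/-! ### Entringer numbers -/

/-- The number of alternating permutations of `Fin (n + 1)` whose first value is `k`. -/
def entringer (n k : ℕ) : ℕ :=
  Nat.card {σ : Equiv.Perm (Fin (n + 1)) // IsAlternating σ ∧ (σ 0 : ℕ) = k}

/-- Deleting the first value leaves a sequence that begins with a descent; reversing the values
makes it alternating again. The bound on `τ 0` encodes the initial ascent from `k`. -/
lemma isAlternating_insertPerm_zero {n : ℕ} (k : Fin (n + 2)) (τ : Equiv.Perm (Fin (n + 1))) :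
    IsAlternating (insertPerm 0 k (τ.trans Fin.revPerm)) ↔
      IsAlternating τ ∧ (τ 0 : ℕ) + k ≤ n := by
  have hz : ∀ h, insertPerm 0 k (τ.trans Fin.revPerm) ⟨0, h⟩ = k := fun h =>
    insertPerm_self 0 k _
  have hs : ∀ (i : ℕ) (h : i + 1 < n + 2), insertPerm 0 k (τ.trans Fin.revPerm) ⟨i + 1, h⟩
      = k.succAbove (Fin.rev (τ ⟨i, Nat.lt_of_succ_lt_succ h⟩)) := fun i h => by
    have := insertPerm_succAbove 0 k (τ.trans Fin.revPerm) ⟨i, Nat.lt_of_succ_lt_succ h⟩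
    simpa using this
  have h0 : k < k.succAbove (Fin.rev (τ 0)) ↔ (τ 0 : ℕ) + k ≤ n := by
    rw [Fin.lt_succAbove_iff_le_castSucc, Fin.le_def]
    have := (τ 0).isLt
    simp only [Fin.val_castSucc, Fin.val_rev]
    omega
  constructor
  · intro H
    refine ⟨fun i h => ?_, ?_⟩
    · have := H (i + 1) (by omega)
      rw [hs, hs, Fin.succAbove_lt_succAbove_iff, Fin.succAbove_lt_succAbove_iff, Fin.rev_lt_rev,
        Fin.rev_lt_rev] at this
      exact ⟨fun hi => this.2 hi.add_one, fun hi => this.1 hi.add_one⟩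
    · have := (H 0 (by omega)).1 (by simp)
      rw [hz, hs] at this
      exact h0.1 this
  · rintro ⟨H, hk⟩ i h
    rcases i with _ | i
    · rw [hz, hs]
      exact ⟨fun _ => h0.2 hk, fun hi => by simp at hi⟩
    · rw [hs, hs, Fin.succAbove_lt_succAbove_iff, Fin.succAbove_lt_succAbove_iff, Fin.rev_lt_rev,
        Fin.rev_lt_rev]
      have := H i (by omega)
      exact ⟨fun hi => this.2 (by simpa [Nat.even_add_one] using hi),
        fun hi => this.1 (by simpa [Nat.odd_add_one] using hi)⟩

lemma entringer_succ {n k : ℕ} (hk : k ≤ n + 1) :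
    entringer (n + 1) k =
      Nat.card {τ : Equiv.Perm (Fin (n + 1)) // IsAlternating τ ∧ (τ 0 : ℕ) + k ≤ n} := by
  symm
  let k' : Fin (n + 2) := ⟨k, by omega⟩
  refine Nat.card_eq_of_bijective
    (fun τ => ⟨insertPerm 0 k' (τ.1.trans Fin.revPerm),
      (isAlternating_insertPerm_zero k' τ.1).2 τ.2, by simp [k']⟩) ⟨?_, ?_⟩
  · intro τ τ' h
    have := insertPerm_injective _ _ (Subtype.ext_iff.1 h)
    ext1
    ext1 i
    simpa using DFunLike.congr_fun this i
  · rintro ⟨σ, hσ, h0⟩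
    obtain ⟨ρ, rfl⟩ := exists_insertPerm_eq (b := k') (σ := σ) (a := 0) (Fin.ext h0)
    have hρ : (ρ.trans Fin.revPerm).trans Fin.revPerm = ρ := by ext1 i; simp
    refine ⟨⟨ρ.trans Fin.revPerm, (isAlternating_insertPerm_zero k' _).1 (by rwa [hρ])⟩, ?_⟩
    simp [hρ]

lemma entringer_succ_zero (n : ℕ) : entringer (n + 1) 0 = A (n + 1) := by
  rw [entringer_succ (Nat.zero_le _), A]
  refine Nat.card_congr (Equiv.subtypeEquivRight fun τ => ?_)
  have := (τ 0).isLt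
  simp only [and_iff_left_iff_imp]
  omega

lemma entringer_succ_self (n : ℕ) : entringer (n + 1) (n + 1) = 0 := by
  rw [entringer_succ le_rfl, Nat.card_eq_zero]
  left
  refine ⟨fun τ => ?_⟩
  have := τ.2.2
  omega

lemma entringer_zero_zero : entringer 0 0 = 1 := by
  rw [entringer, Nat.card_eq_one_iff_unique]
  refine ⟨⟨fun σ τ => Subtype.ext (Equiv.ext fun i =>
    Subsingleton.elim (α := Fin 1) _ _)⟩, ⟨⟨1, fun i h => by omega, by simp⟩⟩⟩

/-- The boustrophedon recurrence: by `entringer_succ`, lowering `k + 1` to `k` admits exactly the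
`τ` with `τ 0 = n - k`. -/
lemma entringer_succ_add {n k : ℕ} (hk : k ≤ n) :
    entringer (n + 1) (k + 1) + entringer n (n - k) = entringer (n + 1) k := by
  classical
  rw [entringer_succ (by omega), entringer_succ (by omega), entringer]
  simp only [Nat.card_eq_fintype_card, Fintype.card_subtype]
  rw [← Finset.card_union_of_disjoint]
  · congr 1
    ext τ
    simp only [Finset.mem_union, Finset.mem_filter, Finset.mem_univ, true_and, ← and_or_left]
    refine and_congr_right fun _ => ?_
    omega
  · rw [Finset.disjoint_filter]
    rintro τ - ⟨-, h⟩ ⟨-, h'⟩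
    omega

/-! ### The density of the first value -/

/-- The polynomial `∑ₖ entringer n k · xᵏ(1 - x)ⁿ⁻ᵏ / (k! (n - k)!)`. -/
def entringerPoly (n : ℕ) (x : ℝ) : ℝ :=
  ∑ k ∈ Finset.range (n + 1), (entringer n k : ℝ) *
    (x ^ k / k.factorial * ((1 - x) ^ (n - k) / (n - k).factorial))

lemma entringerPoly_zero (x : ℝ) : entringerPoly 0 x = 1 := by
  simp [entringerPoly, entringer_zero_zero]

lemma entringerPoly_succ_apply_one (n : ℕ) : entringerPoly (n + 1) 1 = 0 := by
  rw [entringerPoly, Finset.sum_range_succ, entringer_succ_self]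
  simp only [Nat.cast_zero, zero_mul, add_zero, sub_self]
  refine Finset.sum_eq_zero fun k hk => ?_
  rw [zero_pow (by have := Finset.mem_range.1 hk; omega)]
  simp

lemma entringerPoly_succ_apply_zero (n : ℕ) :
    entringerPoly (n + 1) 0 = (A (n + 1) : ℝ) / (n + 1).factorial := by
  rw [entringerPoly, Finset.sum_range_succ', Finset.sum_eq_zero (by intro k _; simp)]
  simp [entringer_succ_zero, div_eq_mul_inv]

lemma hasDerivAt_pow_succ_div_factorial (j : ℕ) (x : ℝ) :
    HasDerivAt (fun x : ℝ => x ^ (j + 1) / (j + 1).factorial) (x ^ j / j.factorial) x := by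
  refine ((hasDerivAt_pow (j + 1) x).div_const ((j + 1).factorial : ℝ)).congr_deriv ?_
  rw [Nat.factorial_succ]
  push_cast
  have : (j.factorial : ℝ) ≠ 0 := by positivity
  field_simp

lemma hasDerivAt_entringerPoly_succ (n : ℕ) (x : ℝ) :
    HasDerivAt (entringerPoly (n + 1)) (-entringerPoly n (1 - x)) x := by
  -- The case `j = 0` is separate because truncated subtraction would give derivative `1` for a
  -- constant.
  let d : ℕ → ℝ → ℝ := fun j x => if j = 0 then 0 else x ^ (j - 1) / (j - 1).factorial
  have hd : ∀ (j : ℕ) (x : ℝ), HasDerivAt (fun x : ℝ => x ^ j / j.factorial) (d j x) x := by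
    intro j x
    rcases j with _ | j
    · simpa [d] using hasDerivAt_const x (1 : ℝ)
    · simpa [d] using hasDerivAt_pow_succ_div_factorial j x
  have hd' : ∀ (j : ℕ), HasDerivAt (fun x : ℝ => (1 - x) ^ j / j.factorial) (-d j (1 - x)) x := by
    intro j
    exact HasDerivAt.comp_const_sub 1 x (hd j (1 - x))
  have key : HasDerivAt (entringerPoly (n + 1)) (∑ k ∈ Finset.range (n + 2),
      (entringer (n + 1) k : ℝ) *
        (d k x * ((1 - x) ^ (n + 1 - k) / (n + 1 - k).factorial) +
          x ^ k / k.factorial * (-d (n + 1 - k) (1 - x)))) x :=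
    HasDerivAt.fun_sum fun k _ => ((hd k x).mul (hd' (n + 1 - k))).const_mul _
  refine key.congr_deriv (Eq.symm ?_)
  simp only [mul_add, Finset.sum_add_distrib]
  -- Both boundary terms vanish. Shifting one sum and reflecting `entringerPoly n (1 - x)` aligns
  -- the monomials `x ^ k * (1 - x) ^ (n - k)`, whose coefficients then match by
  -- `entringer_succ_add`.
  rw [Finset.sum_range_succ' _ (n + 1), Finset.sum_range_succ _ (n + 1), entringerPoly,
    ← Finset.sum_range_reflect, ← Finset.sum_neg_distrib]
  simp only [entringer_succ_self, Nat.cast_zero, zero_mul, add_zero, d, if_true, mul_zero]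
  rw [← Finset.sum_add_distrib]
  refine Finset.sum_congr rfl fun k hk => ?_
  have hk : k ≤ n := by have := Finset.mem_range.1 hk; omega
  have h1 : n + 1 - 1 - k = n - k := by omega
  have h2 : n - (n - k) = k := by omega
  have h3 : n + 1 - (k + 1) = n - k := by omega
  have h4 : n + 1 - k - 1 = n - k := by omega
  have h5 : n + 1 - k ≠ 0 := by omega
  have h6 : k + 1 - 1 = k := rfl
  simp only [h1, h2, h3, h4, h5, h6, if_false, Nat.succ_ne_zero]
  rw [← entringer_succ_add hk]
  push_cast
  ring

/-! ### Cyclically alternating permutations -/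

/-- The last index is odd and its successor in `Fin` is `0`, so the closing inequality is one more
descent. This form makes invariance under even rotations visible. -/
lemma isCyclicallyAlternating_iff {p : ℕ} (σ : Equiv.Perm (Fin (2 * p + 1 + 1))) :
    IsCyclicallyAlternating σ ↔ ∀ i : Fin (2 * p + 1 + 1),
      (Even (i : ℕ) → σ i < σ (i + 1)) ∧ (Odd (i : ℕ) → σ (i + 1) < σ i) := by
  have hlast : Fin.last (2 * p + 1) + 1 = 0 := by simp
  have hsucc : ∀ (i : ℕ) (h : i + 1 < 2 * p + 1 + 1),
      (⟨i, Nat.lt_of_succ_lt h⟩ : Fin (2 * p + 1 + 1)) + 1 = ⟨i + 1, h⟩ := by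
    intro i h
    apply Fin.ext
    rw [Fin.val_add_one_of_lt]
    rw [Fin.lt_def]
    simp only [Fin.val_last]
    omega
  constructor
  · rintro ⟨H, -, H0⟩ i
    rcases Fin.eq_castSucc_or_eq_last i with ⟨j, rfl⟩ | rfl
    · have := H j (by omega)
      rw [← hsucc j (by omega)] at this
      exact this
    · rw [hlast]
      refine ⟨fun h => ?_, fun _ => H0 (by omega)⟩
      simp at h
  · intro H
    refine ⟨fun i h => ?_, ⟨p + 1, by ring⟩, fun h => ?_⟩
    · rw [← hsucc i h]
      exact H ⟨i, Nat.lt_of_succ_lt h⟩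
    · have := (H (Fin.last _)).2 (by simp)
      rw [hlast] at this
      exact this

lemma even_val_add_iff {p : ℕ} (i c : Fin (2 * p + 1 + 1)) (hc : Even (c : ℕ)) :
    Even ((i + c : Fin (2 * p + 1 + 1)) : ℕ) ↔ Even (i : ℕ) := by
  have h2 : 2 ∣ 2 * p + 1 + 1 := ⟨p + 1, by ring⟩
  rw [Fin.val_add, Nat.even_iff, Nat.mod_mod_of_dvd _ h2, ← Nat.even_iff, Nat.even_add]
  simp [hc]

lemma IsCyclicallyAlternating.rotate {p : ℕ} {σ : Equiv.Perm (Fin (2 * p + 1 + 1))}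
    (hσ : IsCyclicallyAlternating σ) {c : Fin (2 * p + 1 + 1)} (hc : Even (c : ℕ)) :
    IsCyclicallyAlternating ((Equiv.addRight c).trans σ) := by
  rw [isCyclicallyAlternating_iff] at hσ ⊢
  intro i
  have := hσ (i + c)
  rw [← Nat.not_even_iff_odd, even_val_add_iff i c hc, Nat.not_even_iff_odd] at this
  simpa [add_right_comm] using this

lemma isCyclicallyAlternating_insertPerm_last {p : ℕ} (τ : Equiv.Perm (Fin (2 * p + 1))) :
    IsCyclicallyAlternating (insertPerm (Fin.last _) (Fin.last _) τ) ↔ IsAlternating τ := by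
  set ρ := insertPerm (Fin.last _) (Fin.last _) τ with hρ
  have hl : ∀ h, ρ ⟨2 * p + 1, h⟩ = Fin.last _ := fun h => insertPerm_self (Fin.last _) _ _
  have hs : ∀ (i : ℕ) (h : i < 2 * p + 1), ρ ⟨i, Nat.lt_succ_of_lt h⟩ = (τ ⟨i, h⟩).castSucc := by
    intro i h
    have := insertPerm_succAbove (Fin.last _) (Fin.last _) τ ⟨i, h⟩
    rw [Fin.succAbove_last_apply, Fin.succAbove_last_apply] at this
    exact this
  constructor
  · rintro ⟨H, -, -⟩ i h
    have := H i (by omega)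
    rw [hs i (by omega), hs (i + 1) h] at this
    exact this
  · intro H
    refine ⟨fun i h => ?_, ⟨p + 1, by ring⟩, fun h => ?_⟩
    · by_cases hi : i + 1 < 2 * p + 1
      · rw [hs i (by omega), hs (i + 1) hi]
        exact H i hi
      · obtain rfl : i = 2 * p := by omega
        rw [hl, hs (2 * p) (by omega)]
        exact ⟨fun _ => Fin.castSucc_lt_last _, fun h => by simp [← Nat.not_even_iff_odd] at h⟩
    · have := hs 0 (by omega)
      rw [this]
      exact (Fin.castSucc_lt_last _).trans_eq (hl _).symm

/-- The pair (even rotation, alternating permutation of the other values) determines the cyclic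
permutation, and is recovered from the position of its maximum. -/
lemma A₀_two_mul_succ (p : ℕ) : A₀ (2 * p + 1 + 1) = (p + 1) * A (2 * p + 1) := by
  let c : Fin (p + 1) → Fin (2 * p + 1 + 1) := fun j => ⟨2 * j, by omega⟩
  have hc : ∀ j, Even (c j : ℕ) := fun j => by simp [c]
  have hcinj : Function.Injective c := by
    intro j j' h
    have := Fin.ext_iff.1 h
    simp only [c] at this
    exact Fin.ext (by omega)
  have hcard : Nat.card (Fin (p + 1) × {τ : Equiv.Perm (Fin (2 * p + 1)) // IsAlternating τ})
      = (p + 1) * A (2 * p + 1) := by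
    rw [Nat.card_prod, Nat.card_fin, A]
  rw [← hcard, A₀]
  symm
  refine Nat.card_eq_of_bijective (fun x =>
    ⟨(Equiv.addRight (c x.1)).trans (insertPerm (Fin.last _) (Fin.last _) x.2.1),
      ((isCyclicallyAlternating_insertPerm_last _).2 x.2.2).rotate (hc x.1)⟩) ⟨?_, ?_⟩
  · rintro ⟨j, τ, hτ⟩ ⟨j', τ', hτ'⟩ h
    have h := Subtype.ext_iff.1 h
    simp only at h
    have hj : j = j' := by
      have h1 := DFunLike.congr_fun h (Fin.last _ - c j)
      simp only [Equiv.trans_apply, Equiv.coe_addRight, sub_add_cancel, insertPerm_self] at h1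
      have h2 : Fin.last _ = Fin.last _ - c j + c j' :=
        (insertPerm (Fin.last _) (Fin.last _) τ').injective ((insertPerm_self _ _ _).trans h1)
      apply hcinj
      rw [sub_add_eq_add_sub, eq_sub_iff_add_eq] at h2
      exact add_left_cancel h2
    subst hj
    have : insertPerm (Fin.last _) (Fin.last _) τ = insertPerm (Fin.last _) (Fin.last _) τ' := by
      ext1 x
      simpa using DFunLike.congr_fun h (x - c j)
    have := insertPerm_injective _ _ this
    subst this
    rfl
  · rintro ⟨σ, hσ⟩
    set a := σ.symm (Fin.last _) with ha
    have hσa : σ a = Fin.last _ := by simp [ha]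
    have hodd : Odd (a : ℕ) := by
      by_contra h
      have := ((isCyclicallyAlternating_iff σ).1 hσ a).1 (Nat.not_odd_iff_even.1 h)
      rw [hσa] at this
      exact absurd this (Fin.le_last _).not_gt
    obtain ⟨b, hb⟩ := hodd
    have hblt : b ≤ p := by have := a.isLt; omega
    -- The maximum sits at `2 * b + 1`, at distance `2 * (p - b)` from the last index `2 * p + 1`.
    let j : Fin (p + 1) := ⟨p - b, by omega⟩
    have haj : Fin.last _ - c j = a := by
      rw [sub_eq_iff_eq_add]
      apply Fin.ext
      rw [Fin.val_add, Nat.mod_eq_of_lt]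
      · simp only [c, j, Fin.val_last]; omega
      · simp only [c, j]; omega
    have hneg : Even ((-(c j) : Fin (2 * p + 1 + 1)) : ℕ) := by
      have := even_val_add_iff (-(c j)) (c j) (hc j)
      rw [← this]
      simp
    obtain ⟨τ, hτ⟩ := exists_insertPerm_eq (a := Fin.last _) (b := Fin.last _)
      (σ := (Equiv.addRight (-(c j))).trans σ) (by
        simp only [Equiv.trans_apply, Equiv.coe_addRight, ← sub_eq_add_neg]
        rw [haj, hσa])
    refine ⟨⟨j, τ, ?_⟩, ?_⟩
    · rw [← isCyclicallyAlternating_insertPerm_last, hτ]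
      exact hσ.rotate hneg
    · ext1
      ext1 x
      simp [hτ]

lemma probCyclic_eq (n : ℕ) : probCyclic n = (A₀ n : ℝ) / A n := by
  let _ : MeasurableSpace (Equiv.Perm (Fin n)) := ⊤
  have hmeas : ∀ s : Set (Equiv.Perm (Fin n)), MeasurableSet s := fun _ => trivial
  have hcount : ∀ s : Set (Equiv.Perm (Fin n)),
      (MeasureTheory.Measure.count s).toReal = (Nat.card s : ℝ) := fun s => by
    rw [MeasureTheory.Measure.count_apply (hmeas s), ← s.toFinite.cast_ncard_eq,
      Nat.card_coe_set_eq, ENat.toENNReal_coe, ENNReal.toReal_natCast]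
  have hinter : {σ : Equiv.Perm (Fin n) | IsAlternating σ} ∩ {σ | IsCyclicallyAlternating σ}
      = {σ | IsCyclicallyAlternating σ} :=
    Set.inter_eq_right.2 fun σ hσ => hσ.1
  change (ProbabilityTheory.uniformOn {σ : Equiv.Perm (Fin n) | IsAlternating σ}
    {σ | IsCyclicallyAlternating σ}).toReal = _
  rw [ProbabilityTheory.uniformOn, ProbabilityTheory.cond_apply (hmeas _), hinter,
    ENNReal.toReal_mul, ENNReal.toReal_inv, hcount, hcount, mul_comm, ← div_eq_mul_inv]
  rfl

/-! ### The cosine series -/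

lemma four_mul_add_one_injective : Function.Injective (fun k : ℤ => 4 * k + 1) := fun a b h => by
  simp only at h
  omega

lemma four_mul_add_one_ne_zero (k : ℤ) : 4 * (k : ℝ) + 1 ≠ 0 := by
  have : 4 * k + 1 ≠ 0 := by omega
  exact_mod_cast this

lemma summable_one_div_four_mul_add_one_pow {n : ℕ} (hn : 2 ≤ n) :
    Summable (fun k : ℤ => 1 / (4 * (k : ℝ) + 1) ^ n) := by
  have := (Real.summable_one_div_int_pow.2 (by omega : 1 < n)).comp_injective
    four_mul_add_one_injective
  refine this.congr fun k => ?_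
  simp

/-- The frequencies `(4k + 1)π / 2`, for which the cosine vanishes and the sine is `1` at `1`. -/
def freq (k : ℤ) : ℝ := (4 * (k : ℝ) + 1) * (Real.pi / 2)

lemma freq_ne_zero (k : ℤ) : freq k ≠ 0 :=
  mul_ne_zero (four_mul_add_one_ne_zero k) (by positivity)

lemma inv_freq_pow (k : ℤ) (n : ℕ) :
    (freq k)⁻¹ ^ n = (2 / Real.pi) ^ n * (1 / (4 * (k : ℝ) + 1) ^ n) := by
  rw [freq, mul_inv, mul_pow, inv_div, one_div, inv_pow, mul_comm]

lemma freq_eq (k : ℤ) : freq k = Real.pi / 2 + k * (2 * Real.pi) := by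
  rw [freq]; ring

lemma cos_freq (k : ℤ) : Real.cos (freq k) = 0 := by
  rw [freq_eq, Real.cos_add_int_mul_two_pi, Real.cos_pi_div_two]

lemma sin_freq (k : ℤ) : Real.sin (freq k) = 1 := by
  rw [freq_eq, Real.sin_add_int_mul_two_pi, Real.sin_pi_div_two]

lemma summable_inv_freq_pow {n : ℕ} (hn : 2 ≤ n) : Summable (fun k => (freq k)⁻¹ ^ n) := by
  simp only [inv_freq_pow]
  exact (summable_one_div_four_mul_add_one_pow hn).mul_left _

/-- The series `2 ∑ₖ cos(λₖ x) / λₖⁿ⁺¹` over the frequencies `λₖ`. -/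
def cosSeries (n : ℕ) (x : ℝ) : ℝ := 2 * ∑' k : ℤ, (freq k)⁻¹ ^ (n + 1) * Real.cos (freq k * x)

lemma cosSeries_apply_zero (n : ℕ) :
    cosSeries n 0 = 2 * ((2 / Real.pi) ^ (n + 1) * S (n + 1)) := by
  simp only [cosSeries, S, mul_zero, Real.cos_zero, mul_one, inv_freq_pow, tsum_mul_left]

lemma cosSeries_apply_one (n : ℕ) : cosSeries n 1 = 0 := by
  simp [cosSeries, cos_freq]

/-- Since `cos λ = 0` and `sin λ = 1`, `sin (λ x) = cos (λ (1 - x))`. The bound `1 ≤ n` makes the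
differentiated series absolutely summable; at the base point `1` every term of the original series
vanishes. -/
lemma hasDerivAt_cosSeries_succ {n : ℕ} (hn : 1 ≤ n) (x : ℝ) :
    HasDerivAt (cosSeries (n + 1)) (-cosSeries n (1 - x)) x := by
  have h := hasDerivAt_tsum (𝕜 := ℝ) (F := ℝ) (u := fun k : ℤ => |(freq k)⁻¹ ^ (n + 1)|)
    (g := fun k y => (freq k)⁻¹ ^ (n + 1 + 1) * Real.cos (freq k * y))
    (g' := fun k y => -((freq k)⁻¹ ^ (n + 1) * Real.cos (freq k * (1 - y)))) (y₀ := 1)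
    (summable_inv_freq_pow (by omega)).abs ?_ ?_ (by simp [cos_freq]) x
  · refine (h.const_mul 2).congr_deriv ?_
    rw [tsum_neg, cosSeries]
    ring
  · intro k y
    have h1 : HasDerivAt (fun y => Real.cos (freq k * y))
        (-Real.sin (freq k * y) * (freq k * 1)) y :=
      ((hasDerivAt_id y).const_mul (freq k)).cos
    refine (h1.const_mul ((freq k)⁻¹ ^ (n + 1 + 1))).congr_deriv ?_
    rw [mul_sub, Real.cos_sub, mul_one, cos_freq, sin_freq, pow_succ _ (n + 1)]
    have := freq_ne_zero k
    field_simp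
    ring
  · intro k y
    rw [norm_neg, norm_mul, Real.norm_eq_abs, Real.norm_eq_abs]
    exact mul_le_of_le_one_right (abs_nonneg _) (Real.abs_cos_le_one _)

lemma hasSum_one_div_sq_mul_exp {y : ℝ} (hy : y ∈ Set.Icc (0 : ℝ) 1) :
    HasSum (fun n : ℤ => 1 / (n : ℂ) ^ 2 * Complex.exp (2 * Real.pi * Complex.I * n * y))
      (2 * Real.pi ^ 2 * ((y : ℂ) ^ 2 - y + 6⁻¹)) := by
  have h := hasSum_one_div_pow_mul_fourier_mul_bernoulliFun (k := 2) le_rfl hy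
  simp only [fourier_coe_apply, Complex.ofReal_one, div_one, bernoulliFun_two] at h
  convert h using 1
  push_cast [Nat.factorial]
  rw [mul_pow, Complex.I_sq]
  ring

lemma hasSum_one_div_sq_mul_exp_four {x : ℝ} (hx : x ∈ Set.Icc (0 : ℝ) 1) :
    HasSum (fun k : ℤ => 1 / ((4 * (k : ℂ) + 1)) ^ 2 * Complex.exp (Complex.I * (freq k * x)))
      (Real.pi ^ 2 / 8 * ((1 - x) + Complex.I * x)) := by
  have hr : ∀ r : ℕ, r ≤ 3 → x / 4 + r / 4 ∈ Set.Icc (0 : ℝ) 1 := by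
    intro r hr
    have : (r : ℝ) ≤ 3 := by exact_mod_cast hr
    have hr0 : (0 : ℝ) ≤ r := by positivity
    constructor <;> linarith [hx.1, hx.2]
  -- A roots-of-unity filter: the weights `I⁻ʳ / 4` at the points `(x + r) / 4` keep only the
  -- frequencies `n ≡ 1` modulo `4`.
  have H := (((hasSum_one_div_sq_mul_exp (hr 0 (by simp))).mul_left (1 / 4)).add
    ((hasSum_one_div_sq_mul_exp (hr 1 (by simp))).mul_left (-Complex.I / 4))).add
    (((hasSum_one_div_sq_mul_exp (hr 2 (by simp))).mul_left (-1 / 4)).add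
    ((hasSum_one_div_sq_mul_exp (hr 3 (by simp))).mul_left (Complex.I / 4)))
  have hexp : ∀ (n : ℤ) (r : ℕ),
      Complex.exp (2 * Real.pi * Complex.I * n * ((x / 4 + r / 4 : ℝ) : ℂ))
        = Complex.exp (2 * Real.pi * Complex.I * n * (x / 4)) * (Complex.I ^ n) ^ r := by
    intro n r
    have hI : Complex.I ^ n = Complex.exp (n * (Real.pi / 2 * Complex.I)) := by
      rw [Complex.exp_int_mul, Complex.exp_pi_div_two_mul_I]
    rw [hI, ← Complex.exp_nat_mul, ← Complex.exp_add]
    congr 1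
    push_cast
    ring
  simp only [hexp] at H
  have hval : ∀ n : ℤ, Complex.I ^ n = 1 ∧ n % 4 = 0 ∨ Complex.I ^ n = Complex.I ∧ n % 4 = 1 ∨
      Complex.I ^ n = -1 ∧ n % 4 = 2 ∨ Complex.I ^ n = -Complex.I ∧ n % 4 = 3 := by
    intro n
    have h4 : Complex.I ^ n = Complex.I ^ (n % 4) := by
      conv_lhs => rw [← Int.emod_add_mul_ediv n 4, zpow_add₀ Complex.I_ne_zero, zpow_mul]
      have : Complex.I ^ (4 : ℤ) = 1 := by exact_mod_cast Complex.I_pow_four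
      rw [this, one_zpow, mul_one]
    have : n % 4 = 0 ∨ n % 4 = 1 ∨ n % 4 = 2 ∨ n % 4 = 3 := by omega
    rcases this with h | h | h | h <;> rw [h4, h] <;> simp [zpow_ofNat]
  rw [← four_mul_add_one_injective.hasSum_iff] at H
  · refine (congrArg₂ (fun f a => HasSum f a) (funext fun k => ?_) ?_).mpr H
    · have hI : Complex.I ^ (4 * k + 1) = Complex.I := by
        rcases hval (4 * k + 1) with h | h | h | h <;> first | exact h.1 | omega
      simp only [Function.comp_apply, hI]
      have h2 : Complex.I * (freq k * x)
          = 2 * Real.pi * Complex.I * ((4 * k + 1 : ℤ) : ℂ) * (x / 4) := by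
        rw [freq]; push_cast; ring
      rw [h2]
      push_cast
      linear_combination (1 / (4 * (k : ℂ) + 1) ^ 2 *
        Complex.exp (2 * Real.pi * Complex.I * (4 * k + 1) * (x / 4)) *
          (3 / 4 - Complex.I ^ 2 / 4)) * Complex.I_sq
    · push_cast
      ring
  · intro n hn
    have hmod : n % 4 ≠ 1 := fun h => hn ⟨n / 4, by simp only; omega⟩
    rcases hval n with h | h | h | h
    · simp only [h.1]; ring
    · exact absurd h.2 hmod
    · simp only [h.1]; ring
    · rw [h.1]
      ring_nf
      simp only [Complex.I_pow_four]
      ring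

lemma cosSeries_one {x : ℝ} (hx : x ∈ Set.Icc (0 : ℝ) 1) : cosSeries 1 x = 1 - x := by
  have h := Complex.hasSum_re (hasSum_one_div_sq_mul_exp_four hx)
  have h' : HasSum (fun k : ℤ => 1 / (4 * (k : ℝ) + 1) ^ 2 * Real.cos (freq k * x))
      (Real.pi ^ 2 / 8 * (1 - x)) := by
    convert h using 1
    · ext k
      have : (1 : ℂ) / (4 * (k : ℂ) + 1) ^ 2 = ((1 / (4 * (k : ℝ) + 1) ^ 2 : ℝ) : ℂ) := by
        push_cast; rfl
      rw [this, Complex.re_ofReal_mul, mul_comm Complex.I, ← Complex.ofReal_mul,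
        Complex.exp_ofReal_mul_I_re]
    · have : (Real.pi : ℂ) ^ 2 / 8 = ((Real.pi ^ 2 / 8 : ℝ) : ℂ) := by push_cast; rfl
      rw [this, Complex.re_ofReal_mul]
      simp
  rw [cosSeries]
  simp only [inv_freq_pow, mul_assoc, tsum_mul_left, h'.tsum_eq]
  have := Real.pi_ne_zero
  rw [div_pow]
  field_simp
  ring

/-- Both families satisfy the same differential recursion and vanish at `1`. The induction starts at
`1`, where the series is summed explicitly, because `cosSeries 0` is not absolutely convergent. -/
lemma entringerPoly_eq_cosSeries {n : ℕ} (hn : 1 ≤ n) {x : ℝ} (hx : x ∈ Set.Icc (0 : ℝ) 1) :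
    entringerPoly n x = cosSeries n x := by
  have key : ∀ (f f' g : ℝ → ℝ), (∀ x, HasDerivAt f (f' x) x) → f 1 = g 1 →
      (∀ x ∈ Set.Icc (0 : ℝ) 1, HasDerivAt g (f' x) x) →
      ∀ x ∈ Set.Icc (0 : ℝ) 1, f x = g x := by
    intro f f' g hf h1 hg x hx
    have hd : ∀ t ∈ Set.Icc (0 : ℝ) 1, HasDerivAt (fun t => f t - g t) 0 t := fun t ht =>
      ((hf t).sub (hg t ht)).congr_deriv (sub_self _)
    have := (convex_Icc (0 : ℝ) 1).is_const_of_fderivWithin_eq_zero (𝕜 := ℝ)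
      (f := fun t => f t - g t)
      (fun t ht => (hd t ht).differentiableAt.differentiableWithinAt)
      (fun t ht => by
        ext
        rw [fderivWithin_derivWithin,
          (hd t ht).hasDerivWithinAt.derivWithin (uniqueDiffOn_Icc_zero_one t ht)]
        simp) hx (Set.right_mem_Icc.2 zero_le_one)
    simp only [h1, sub_self] at this
    linarith
  induction n, hn using Nat.le_induction generalizing x with
  | base =>
    rw [cosSeries_one hx]
    refine key (entringerPoly 1) _ (fun x => 1 - x) (hasDerivAt_entringerPoly_succ 0) ?_ ?_ x hx
    · simp [entringerPoly_succ_apply_one]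
    · intro x _
      rw [entringerPoly_zero]
      exact (hasDerivAt_id x).const_sub 1
  | succ n hn ih =>
    refine key _ _ _ (hasDerivAt_entringerPoly_succ n) ?_ ?_ x hx
    · rw [entringerPoly_succ_apply_one, cosSeries_apply_one]
    · intro x hx
      rw [ih (x := 1 - x) ⟨by linarith [hx.2], by linarith [hx.1]⟩]
      exact hasDerivAt_cosSeries_succ hn x

lemma A_eq {n : ℕ} (hn : 1 ≤ n) :
    (A n : ℝ) = n.factorial * (2 * ((2 / Real.pi) ^ (n + 1) * S (n + 1))) := by
  obtain ⟨n, rfl⟩ := Nat.exists_eq_add_of_le' hn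
  rw [← cosSeries_apply_zero, ← entringerPoly_eq_cosSeries hn (by simp),
    entringerPoly_succ_apply_zero]
  field_simp

lemma A₀_div_A_eq_mul {m : ℕ} (hm : 1 ≤ m) :
    (A₀ (2 * m) : ℝ) / A (2 * m) = m * ((A (2 * m - 1) : ℝ) / A (2 * m)) := by
  obtain ⟨p, rfl⟩ := Nat.exists_eq_add_of_le' hm
  have h : A₀ (2 * (p + 1)) = (p + 1) * A (2 * (p + 1) - 1) := A₀_two_mul_succ p
  rw [h, Nat.cast_mul, mul_div_assoc]

lemma A₀_div_A_eq_S_div_S {m : ℕ} (hm : 1 ≤ m) :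
    (A₀ (2 * m) : ℝ) / A (2 * m) = Real.pi / 4 * (S (2 * m) / S (2 * m + 1)) := by
  rw [A₀_div_A_eq_mul hm, A_eq (by omega : 1 ≤ 2 * m - 1), A_eq (by omega : 1 ≤ 2 * m),
    Nat.sub_add_cancel (by omega : 1 ≤ 2 * m), ← Nat.mul_factorial_pred (by omega : 2 * m ≠ 0)]
  have hm0 : (m : ℝ) ≠ 0 := by positivity
  have hf : ((2 * m - 1).factorial : ℝ) ≠ 0 := by positivity
  have hpi := Real.pi_ne_zero
  push_cast
  -- If the denominator vanished, both sides would be `0` by the convention for division, so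
  -- positivity of `S` is not needed.
  rcases eq_or_ne (S (2 * m + 1)) 0 with h0 | h0
  · simp [h0]
  · simp only [div_pow, pow_succ _ (2 * m)]
    field_simp
    ring

/-! ### Asymptotics of `S` -/

/-- `(-3)ⁿ (S n - 1)`, whose leading term comes from `k = -1`. -/
def scaledTail (n : ℕ) : ℝ := ∑' k : ℤ, if k = 0 then 0 else (-3 / (4 * (k : ℝ) + 1)) ^ n

lemma tendsto_scaledTail : Tendsto scaledTail atTop (𝓝 1) := by
  have habs : ∀ k : ℤ, k ≠ 0 → 3 ≤ |4 * (k : ℝ) + 1| := by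
    intro k hk
    have : 3 ≤ |4 * k + 1| := by
      rcases lt_or_gt_of_ne hk with h | h
      · exact le_abs.2 (Or.inr (by omega))
      · exact le_abs.2 (Or.inl (by omega))
    exact_mod_cast this
  have hone : (∑' k : ℤ, if k = -1 then (1 : ℝ) else 0) = 1 := tsum_ite_eq _ _
  rw [← hone]
  -- Only `k = -1` has a base of modulus not below `1`, and that base is `1`. For `n ≥ 2` each power
  -- is bounded by its square, which gives the factor `9`.
  refine tendsto_tsum_of_dominated_convergence
    (bound := fun k : ℤ => 9 * (1 / (4 * (k : ℝ) + 1) ^ 2))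
    ((summable_one_div_four_mul_add_one_pow le_rfl).mul_left 9) ?_ ?_
  · intro k
    by_cases h0 : k = 0
    · simp [h0]
    · by_cases h1 : k = -1
      · subst h1
        norm_num
      · simp only [h0, h1, if_false]
        refine tendsto_pow_atTop_nhds_zero_of_abs_lt_one ?_
        have h5 : 5 ≤ |4 * k + 1| := by
          rcases lt_or_gt_of_ne h0 with h | h
          · exact le_abs.2 (Or.inr (by omega))
          · exact le_abs.2 (Or.inl (by omega))
        have h5 : 5 ≤ |4 * (k : ℝ) + 1| := by exact_mod_cast h5
        rw [abs_div, div_lt_one (by linarith), abs_neg, abs_of_pos (by norm_num)]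
        linarith
  · filter_upwards [eventually_ge_atTop 2] with n hn k
    by_cases h0 : k = 0
    · simp [h0]
    · simp only [h0, if_false]
      have h3 := habs k h0
      have hle : |-3 / (4 * (k : ℝ) + 1)| ≤ 1 := by
        rw [abs_div, div_le_one (by linarith), abs_neg, abs_of_pos (by norm_num)]
        exact h3
      rw [Real.norm_eq_abs, abs_pow]
      refine (pow_le_pow_of_le_one (abs_nonneg _) hle hn).trans_eq ?_
      rw [sq_abs, div_pow]
      ring

lemma S_eq {n : ℕ} (hn : 2 ≤ n) : S n = 1 + (-3)⁻¹ ^ n * scaledTail n := by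
  rw [S, (summable_one_div_four_mul_add_one_pow hn).tsum_eq_add_tsum_ite 0, scaledTail,
    ← tsum_mul_left]
  congr 1
  · simp
  · refine tsum_congr fun k => ?_
    split_ifs
    · simp
    · rw [← mul_pow, ← mul_div_assoc, inv_mul_cancel₀ (by norm_num), one_div, one_div, inv_pow]

lemma tendsto_S : Tendsto S atTop (𝓝 1) := by
  have h : Tendsto (fun n => 1 + (-3 : ℝ)⁻¹ ^ n * scaledTail n) atTop (𝓝 (1 + 0 * 1)) :=
    (((tendsto_pow_atTop_nhds_zero_of_abs_lt_one
      (by rw [abs_inv, abs_neg]; norm_num)).mul tendsto_scaledTail)).const_add 1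
  rw [zero_mul, add_zero] at h
  refine h.congr' ?_
  filter_upwards [eventually_ge_atTop 2] with n hn
  exact (S_eq hn).symm

lemma tendsto_two_mul : Tendsto (fun m : ℕ => 2 * m) atTop atTop :=
  tendsto_id.const_mul_atTop' two_pos

lemma tendsto_two_mul_add_one : Tendsto (fun m : ℕ => 2 * m + 1) atTop atTop :=
  (tendsto_add_atTop_nat 1).comp tendsto_two_mul

lemma tendsto_A₀_div_A :
    Tendsto (fun m : ℕ => (A₀ (2 * m) : ℝ) / A (2 * m)) atTop (𝓝 (Real.pi / 4)) := by
  have h := ((tendsto_S.comp tendsto_two_mul).div (tendsto_S.comp tendsto_two_mul_add_one)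
    one_ne_zero).const_mul (Real.pi / 4)
  rw [div_one, mul_one] at h
  refine h.congr' ?_
  filter_upwards [eventually_ge_atTop 1] with m hm
  exact (A₀_div_A_eq_S_div_S hm).symm

lemma A₀_div_A_sub_isEquivalent :
    (fun m : ℕ => (A₀ (2 * m) : ℝ) / A (2 * m) - Real.pi / 4)
      ~[atTop] (fun m : ℕ => Real.pi / 3 * (3 : ℝ) ^ (-(2 * (m : ℤ)))) := by
  refine isEquivalent_of_tendsto_one ?_
  -- The factor `3 / 4` is `(π / 4) / (π / 3)`; the `1 / 3` comes from the extra `(-3)⁻¹` in `S (2 *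
  -- m + 1)`, with its sign flipped by the subtraction.
  have h : Tendsto (fun m : ℕ => 3 / 4 *
      ((scaledTail (2 * m) + 1 / 3 * scaledTail (2 * m + 1)) / S (2 * m + 1))) atTop
      (𝓝 (3 / 4 * ((1 + 1 / 3 * 1) / 1))) :=
    (((tendsto_scaledTail.comp tendsto_two_mul).add
      ((tendsto_scaledTail.comp tendsto_two_mul_add_one).const_mul (1 / 3))).div
      (tendsto_S.comp tendsto_two_mul_add_one) one_ne_zero).const_mul (3 / 4)
  norm_num at h
  refine (h.congr' ?_)
  filter_upwards [eventually_ge_atTop 1,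
    (tendsto_S.comp tendsto_two_mul_add_one).eventually_ne one_ne_zero] with m hm hS
  have hS : S (2 * m + 1) ≠ 0 := hS
  have hpow : (3 : ℝ) ^ (-(2 * (m : ℤ))) = (-3)⁻¹ ^ (2 * m) := by
    rw [zpow_neg, pow_mul, inv_pow, neg_sq, inv_pow, ← pow_mul]
    norm_cast
  have hne : ((-3 : ℝ)⁻¹) ^ (2 * m) ≠ 0 := by positivity
  have hdiff : S (2 * m) - S (2 * m + 1)
      = (-3)⁻¹ ^ (2 * m) * (scaledTail (2 * m) + 1 / 3 * scaledTail (2 * m + 1)) := by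
    rw [S_eq (by omega : 2 ≤ 2 * m), S_eq (by omega : 2 ≤ 2 * m + 1), pow_succ]
    ring
  have hp : Real.pi / 4 * (S (2 * m) / S (2 * m + 1)) - Real.pi / 4
      = Real.pi / 4 * ((S (2 * m) - S (2 * m + 1)) / S (2 * m + 1)) := by
    rw [sub_div, div_self hS]
    ring
  rw [Pi.div_apply, A₀_div_A_eq_S_div_S hm, hpow, hp, hdiff]
  generalize ((-3 : ℝ)⁻¹) ^ (2 * m) = q at hne ⊢
  have := Real.pi_ne_zero
  field_simp

end AltPerm

end

theorem mainTheorem8 :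
    (∀ m : ℕ, 1 ≤ m →
      Summable (fun k : ℤ => 1 / (4 * (k : ℝ) + 1) ^ (2 * m)) ∧
      Summable (fun k : ℤ => 1 / (4 * (k : ℝ) + 1) ^ (2 * m + 1)) ∧
      (AltPerm.A₀ (2 * m) : ℝ) / AltPerm.A (2 * m)
        = m * ((AltPerm.A (2 * m - 1) : ℝ) / AltPerm.A (2 * m)) ∧
      (AltPerm.A₀ (2 * m) : ℝ) / AltPerm.A (2 * m)
        = Real.pi / 4 * (AltPerm.S (2 * m) / AltPerm.S (2 * m + 1)) ∧
      AltPerm.probCyclic (2 * m) = (AltPerm.A₀ (2 * m) : ℝ) / AltPerm.A (2 * m)) ∧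
    Tendsto (fun m : ℕ => (AltPerm.A₀ (2 * m) : ℝ) / AltPerm.A (2 * m)) atTop
      (𝓝 (Real.pi / 4)) ∧
    Tendsto (fun m : ℕ => AltPerm.probCyclic (2 * m)) atTop (𝓝 (Real.pi / 4)) ∧
    ∃ c : ℝ, 0 < c ∧
      (fun m : ℕ => AltPerm.probCyclic (2 * m) - Real.pi / 4)
        ~[atTop] (fun m : ℕ => c * (3 : ℝ) ^ (-(2 * (m : ℤ)))) := by
  refine ⟨fun m hm => ⟨AltPerm.summable_one_div_four_mul_add_one_pow (by omega),
    AltPerm.summable_one_div_four_mul_add_one_pow (by omega), AltPerm.A₀_div_A_eq_mul hm,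
    AltPerm.A₀_div_A_eq_S_div_S hm, AltPerm.probCyclic_eq _⟩, AltPerm.tendsto_A₀_div_A, ?_,
    Real.pi / 3, by positivity, ?_⟩
  · simpa only [AltPerm.probCyclic_eq] using AltPerm.tendsto_A₀_div_A
  · simpa only [AltPerm.probCyclic_eq] using AltPerm.A₀_div_A_sub_isEquivalent
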